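/- **Theorem (Flats are periodic).** Let $X$ be a $\mathrm{CAT}(0)$ space. A $k$-flat in $X$ (with $k\ge 2$) is the image of an isometric embedding of Euclidean space $\mathbb{E}^k$ into $X$; a flat is a $k$-flat for some $k\ge 2$. Suppose that $X$ has isolated flats with respect to a family $\mathcal F$ of flats, that is: 1. (Maximal) there is a constant $B$ such that every flat in $X$ is contained in the $B$-neighborhood of some $F'\in\mathcal F$; 2. (Isolated) there is a function $\psi\colon [0,\infty)\to[0,\infty)$ such that for all distinct $F_1,F_2\in\mathcal F$ and all $r\ge 0$ the intersection $\mathcal N_r(F_1)\cap \mathcal N_r(F_2)$ of the $r$-neighborhoods has diameter at most $\psi(r)$; 3. (Equivariant) $\varphi(F)\in\mathcal F$ for every $F\in\mathcal F$ and every isometry $\varphi\in\mathrm{Isom}(X)$. Let $G$ be a group acting geometrically on $X$, that is, properly discontinuously, cocompactly (the $G$-translates of some compact set cover $X$) and by isometries. Then every $F\in\mathcal F$ is periodic: if $F$ is a $k$-flat, then there is a subgroup $A\le G$, free abelian of rank $k$, that acts on $F$ by Euclidean translations with quotient $A\backslash F$ a $k$-torus. -/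

import Mathlib

/-- `γ`, restricted to `[0, d(x, y)]`, is a geodesic from `x` to `y`. -/
structure IsGeodesic {X : Type*} [MetricSpace X] (γ : ℝ → X) (x y : X) : Prop where
  source : γ 0 = x
  target : γ (dist x y) = y
  isometric : ∀ s ∈ Set.Icc 0 (dist x y), ∀ t ∈ Set.Icc 0 (dist x y), dist (γ s) (γ t) = |s - t|

/-- A `CAT(0)` space: a geodesic metric space in which distances between points of a geodesic
triangle are at most the distances between the corresponding points of a comparison triangle
in the Euclidean plane.

Two distinct sides of a triangle share a vertex, here called `p`, and for two points on the same
side the comparison holds trivially. So it is enough to compare a point of a side `[p, q]` with a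
point of a side `[p, r]`, for all triples of vertices and all choices of the geodesics. The third
side exists and plays no role. The points `x'`, `y'` are the comparison points of
`γ s`, `η t`. -/
structure IsCAT0 (X : Type*) [MetricSpace X] : Prop where
  geodesic : ∀ x y : X, ∃ γ : ℝ → X, IsGeodesic γ x y
  comparison : ∀ (p q r : X) (p' q' r' : EuclideanSpace ℝ (Fin 2)),
    dist p' q' = dist p q → dist q' r' = dist q r → dist p' r' = dist p r →
    ∀ γ η : ℝ → X, IsGeodesic γ p q → IsGeodesic η p r →
    ∀ s ∈ Set.Icc 0 (dist p q), ∀ t ∈ Set.Icc 0 (dist p r),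
    ∀ x' ∈ segment ℝ p' q', dist p' x' = s → ∀ y' ∈ segment ℝ p' r', dist p' y' = t →
    dist (γ s) (η t) ≤ dist x' y'

/-- A geometric action: isometric, properly discontinuous and cocompact. -/
structure IsGeometricAction (G X : Type*) [Group G] [MetricSpace X] [MulAction G X] : Prop where
  isometric : IsIsometricSMul G X
  properlyDiscontinuous : ProperlyDiscontinuousSMul G X
  cocompact : ∃ K : Set X, IsCompact K ∧ ∀ x : X, ∃ g : G, ∃ y ∈ K, g • y = x

/-- A `k`-flat, as a subset: the image of an isometric embedding of Euclidean `k`-space, where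
`k ≥ 2`. -/
def IsFlatOfDim {X : Type*} [MetricSpace X] (k : ℕ) (F : Set X) : Prop :=
  2 ≤ k ∧ ∃ f : EuclideanSpace ℝ (Fin k) → X, Isometry f ∧ Set.range f = F

/-- A flat of some dimension `k ≥ 2`. -/
def IsFlat {X : Type*} [MetricSpace X] (F : Set X) : Prop :=
  ∃ k : ℕ, IsFlatOfDim k F

/-- `X` has isolated flats with respect to the distinguished family `𝓕`. -/
structure HasIsolatedFlatsWith (X : Type*) [MetricSpace X] (𝓕 : Set (Set X)) : Prop where
  isFlat : ∀ F ∈ 𝓕, IsFlat F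
  maximal : ∃ B : ℝ, ∀ F : Set X, IsFlat F → ∃ F' ∈ 𝓕, F ⊆ Metric.thickening B F'
  isolated : ∃ ψ : NNReal → NNReal, ∀ F₁ ∈ 𝓕, ∀ F₂ ∈ 𝓕, F₁ ≠ F₂ → ∀ k : NNReal,
    ∀ x ∈ Metric.thickening (k : ℝ) F₁ ∩ Metric.thickening (k : ℝ) F₂,
    ∀ y ∈ Metric.thickening (k : ℝ) F₁ ∩ Metric.thickening (k : ℝ) F₂, dist x y ≤ ψ k
  equivariant : ∀ φ : X ≃ᵢ X, ∀ F ∈ 𝓕, φ '' F ∈ 𝓕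

/-- The group `A` acts on the flat `F` (in particular preserves it) by translations, with respect
to any identification of `F` with Euclidean `k`-space. -/
def ActsByTranslations {X : Type*} [MetricSpace X] (A : Type*) [Group A] [MulAction A X]
    (k : ℕ) (F : Set X) : Prop :=
  ∀ f : EuclideanSpace ℝ (Fin k) → X, Isometry f → Set.range f = F →
    ∀ a : A, ∃ v : EuclideanSpace ℝ (Fin k), ∀ x, a • f x = f (x + v)

/-- The quotient `A \ F`, with the quotient topology from the subspace `F`: two points of `F` are
identified when they lie in the same `A`-orbit. -/
abbrev FlatQuotient {X : Type*} (A : Type*) [Group A] [MulAction A X] (F : Set X) : Type _ :=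
  Quotient ((MulAction.orbitRel A X).comap (Subtype.val : F → X))

/-- A `k`-flat `F` is periodic if some free abelian subgroup `A ≤ G` of rank `k` acts on `F` by
translations with quotient homeomorphic to the `k`-torus. -/
def IsPeriodicFlat (G : Type*) {X : Type*} [Group G] [MetricSpace X] [MulAction G X]
    (k : ℕ) (F : Set X) : Prop :=
  IsFlatOfDim k F ∧ ∃ A : Subgroup G,
    Nonempty (A ≃* Multiplicative (Fin k → ℤ)) ∧
    ActsByTranslations A k F ∧
    Nonempty (FlatQuotient A F ≃ₜ UnitAddTorus (Fin k))

/-! Isolation makes `𝓕` locally finite: two members that stay close on a large ball would overlap in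
too large a set (`HasIsolatedFlatsWith.locallyFinite`). So only finitely many translates of `F` meet
a compact set whose translates cover `X`, and the stabilizer of `F` acts cocompactly on `F`
(`IsGeometricAction.exists_stabilizer_dist_le`). On `F ≅ 𝔼ᵏ` it acts by isometries `x ↦ L g x + t
g`, discretely by proper discontinuity.

The first Bieberbach theorem (`span_translations_eq_top`) then supplies `k` independent
translations. It rests on contraction of commutators: rotations close to the identity have iterated
commutators that become trivial, which with cocompactness forces such rotations to be trivial. The
action on `F` may have a finite kernel, so powers are taken to get commuting lifts in `G`. -/

/-! ### Bieberbach's first theorem, by commutator estimates. -/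

section Bieberbach

open scoped commutatorElement

variable {E : Type*} [NormedAddCommGroup E] [InnerProductSpace ℝ E]

theorem linIsom_mul_apply (A B : E ≃ₗᵢ[ℝ] E) (x : E) : (A * B) x = A (B x) := rfl

theorem linIsom_one_apply (x : E) : (1 : E ≃ₗᵢ[ℝ] E) x = x := rfl

/-- `A` differs from the identity by at most `c` in operator norm. -/
def NearOne (A : E ≃ₗᵢ[ℝ] E) (c : ℝ) : Prop := ∀ x, ‖A x - x‖ ≤ c * ‖x‖

theorem NearOne.mono {A : E ≃ₗᵢ[ℝ] E} {c d : ℝ} (h : NearOne A c) (hcd : c ≤ d) : NearOne A d :=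
  fun x => (h x).trans (mul_le_mul_of_nonneg_right hcd (norm_nonneg x))

/-- `AB - BA = (A - 1)(B - 1) - (B - 1)(A - 1)`, and the remaining factor `(BA)⁻¹` preserves norms.
-/
theorem NearOne.commutator {A B : E ≃ₗᵢ[ℝ] E} {c d : ℝ} (hc : 0 ≤ c) (hd : 0 ≤ d)
    (hA : NearOne A c) (hB : NearOne B d) : NearOne ⁅A, B⁆ (2 * c * d) := by
  intro x
  obtain ⟨y, rfl⟩ : ∃ y, x = (B * A) y := ⟨(B * A)⁻¹ x, by
    rw [← linIsom_mul_apply, mul_inv_cancel, linIsom_one_apply]⟩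
  have e : ⁅A, B⁆ ((B * A) y) = A (B y) := by
    rw [← linIsom_mul_apply, ← linIsom_mul_apply, commutatorElement_def]
    congr 1
    group
  have e2 : A (B y) - (B * A) y = (A (B y - y) - (B y - y)) - (B (A y - y) - (A y - y)) := by
    simp only [map_sub, linIsom_mul_apply]
    abel
  rw [e, e2]
  have h1 := hA (B y - y)
  have h2 := hB (A y - y)
  have h3 := mul_le_mul_of_nonneg_left (hB y) hc
  have h4 := mul_le_mul_of_nonneg_left (hA y) hd
  have h5 := norm_sub_le (A (B y - y) - (B y - y)) (B (A y - y) - (A y - y))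
  rw [linIsom_mul_apply, B.norm_map, A.norm_map]
  linarith

/-- From `V² - 1 = 2(V - 1) + (V - 1)²`, each squaring multiplies a displacement by at least `2 - c
> 1`, so a nonzero one would grow without bound. -/
theorem eq_one_of_forall_pow_nearOne {U : E ≃ₗᵢ[ℝ] E} {c : ℝ} (hc : c < 1)
    (hU : ∀ n : ℕ, NearOne (U ^ n) c) : U = 1 := by
  ext x
  rw [linIsom_one_apply]
  by_contra hx
  have hpos : 0 < ‖U x - x‖ := norm_pos_iff.2 (sub_ne_zero.2 hx)
  have key : ∀ k : ℕ, (2 - c) ^ k * ‖U x - x‖ ≤ ‖(U ^ (2 ^ k)) x - x‖ := by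
    intro k
    induction k with
    | zero => simp
    | succ k ih =>
      set V := U ^ (2 ^ k) with hV
      have e : U ^ (2 ^ (k + 1)) = V * V := by rw [hV, ← pow_add]; congr 1; ring
      have h1 := hU (2 ^ k) (V x - x)
      rw [← hV] at h1
      have e2 : (V * V) x - x = (2 : ℝ) • (V x - x) + (V (V x - x) - (V x - x)) := by
        rw [linIsom_mul_apply, map_sub, two_smul]; abel
      have h2 := norm_sub_le_norm_add ((2 : ℝ) • (V x - x)) (V (V x - x) - (V x - x))
      rw [← e2, norm_smul, Real.norm_ofNat] at h2
      rw [e, pow_succ]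
      have h3 := mul_le_mul_of_nonneg_left ih (by linarith : 0 ≤ 2 - c)
      linarith
  obtain ⟨k, hk⟩ := pow_unbounded_of_one_lt (c * ‖x‖ / ‖U x - x‖) (by linarith : 1 < 2 - c)
  rw [div_lt_iff₀ hpos] at hk
  linarith [key k, hU (2 ^ k) x]

/-- If `A` commutes with its conjugate by an isometry `B` near the identity, then `A` commutes
with `B`. -/
theorem commute_of_commute_conj {A B : E ≃ₗᵢ[ℝ] E} {c : ℝ} (hc : c < 1 / 2) (hB : NearOne B c)
    (h : Commute A (B * A * B⁻¹)) : Commute A B := by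
  set C := B * A * B⁻¹ with hC
  have hCB : ∀ n : ℕ, C ^ n * B = B * A ^ n := by
    intro n
    rw [hC, conj_pow]
    group
  -- The `n`-th power is `C⁻ⁿAⁿ`. Since `CⁿB = BAⁿ`, it is within `c` of `B`, hence within `2c < 1`
  -- of the identity.
  have hU : C⁻¹ * A = 1 := by
    refine eq_one_of_forall_pow_nearOne (c := 2 * c) (by linarith) fun n x => ?_
    have hcomm : Commute C⁻¹ A := h.symm.inv_left
    rw [hcomm.mul_pow, linIsom_mul_apply]
    have h1 : ‖(C⁻¹ ^ n) ((A ^ n) x) - B x‖ ≤ c * ‖x‖ := by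
      rw [← (C ^ n).norm_map, map_sub, ← linIsom_mul_apply,
        ← linIsom_mul_apply (C ^ n) B, hCB, inv_pow, mul_inv_cancel,
        linIsom_one_apply, linIsom_mul_apply, norm_sub_rev]
      simpa using hB ((A ^ n) x)
    have h2 := hB x
    have h3 := norm_add_le ((C⁻¹ ^ n) ((A ^ n) x) - B x) (B x - x)
    rw [sub_add_sub_cancel] at h3
    linarith
  have hCA : C = A := (inv_mul_eq_one.1 hU)
  have := hCB 1
  rw [pow_one, pow_one, hCA] at this
  exact this

/-- The image of `A - 1` is orthogonal to the fixed vectors of `A`; here `A v - v` is both. -/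
theorem apply_sub_self_eq_zero {A : E ≃ₗᵢ[ℝ] E} {v : E} (h : A (A v - v) = A v - v) :
    A v = v := by
  rw [← sub_eq_zero, ← inner_self_eq_zero (𝕜 := ℝ)]
  conv_lhs => rw [inner_sub_right]
  conv_lhs => enter [1]; rw [← h, A.inner_map_map]
  exact sub_self _

variable {S : Type*} [Group S] (L : S →* (E ≃ₗᵢ[ℝ] E)) (t : S → E)

theorem crossed_commutator (ht : ∀ g h, t (g * h) = t g + L g (t h)) (g h : S) :
    t ⁅g, h⁆ = t g + L g (t h) - L ⁅g, h⁆ (t h + L h (t g)) := by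
  have : ⁅g, h⁆ * (h * g) = g * h := by rw [commutatorElement_def]; group
  rw [← ht g h, ← this, ht, ht h g, add_sub_cancel_right]

/-- The iterated commutators `[g, [g, …, [g, h]]]`. -/
def iterComm (g h : S) : ℕ → S
  | 0 => h
  | n + 1 => ⁅g, iterComm g h n⁆

theorem iterComm_bound (ht : ∀ g h, t (g * h) = t g + L g (t h)) {g h : S}
    (hg : NearOne (L g) (1 / 8)) (hh : NearOne (L h) (1 / 8)) (n : ℕ) :
    NearOne (L (iterComm g h n)) ((1 / 4) ^ n / 8) ∧
      ‖t (iterComm g h n)‖ ≤ (1 / 2) ^ n * (‖t h‖ + 4 * ‖t g‖) := by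
  induction n with
  | zero =>
    refine ⟨by simpa [iterComm] using hh, ?_⟩
    simp only [iterComm, pow_zero, one_mul]
    linarith [norm_nonneg (t g)]
  | succ n ih =>
    obtain ⟨ih1, ih2⟩ := ih
    set b := iterComm g h n with hb
    have hp : (0 : ℝ) ≤ (1 / 4) ^ n := by positivity
    have hp1 : ((1 : ℝ) / 4) ^ n ≤ 1 := pow_le_one₀ (by norm_num) (by norm_num)
    have hp2 : ((1 : ℝ) / 4) ^ n ≤ (1 / 2) ^ n := pow_le_pow_left₀ (by norm_num) (by norm_num) n
    have hq : (0 : ℝ) ≤ (1 / 2) ^ n := by positivity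
    have hC : NearOne (L ⁅g, b⁆) ((1 / 4) ^ (n + 1) / 8) := by
      rw [map_commutatorElement]
      refine (hg.commutator (by norm_num) (by positivity) ih1).mono ?_
      rw [pow_succ]; linarith
    refine ⟨hC, ?_⟩
    change ‖t ⁅g, b⁆‖ ≤ _
    rw [crossed_commutator L t ht]
    -- Every summand is now a displacement by a rotation near the identity; those of `t g` carry a
    -- factor `4⁻ⁿ`.
    have e : t g + L g (t b) - L ⁅g, b⁆ (t b + L b (t g)) =
        (L g (t b) - t b) - (L ⁅g, b⁆ (t b) - t b)
          - (L b (t g) - t g) - (L ⁅g, b⁆ (L b (t g)) - L b (t g)) := by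
      rw [map_add]; abel
    rw [e]
    have h1 := hg (t b)
    have h2 := hC (t b)
    have h3 := ih1 (t g)
    have h4 := hC (L b (t g))
    rw [LinearIsometryEquiv.norm_map] at h4
    have h5 := norm_sub_le (L g (t b) - t b) (L ⁅g, b⁆ (t b) - t b)
    have h6 := norm_sub_le ((L g (t b) - t b) - (L ⁅g, b⁆ (t b) - t b)) (L b (t g) - t g)
    have h7 := norm_sub_le ((L g (t b) - t b) - (L ⁅g, b⁆ (t b) - t b) - (L b (t g) - t g))
      (L ⁅g, b⁆ (L b (t g)) - L b (t g))
    rw [pow_succ] at h2 h4 ⊢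
    have h8 : (1 / 4) ^ n * (1 / 4) / 8 * ‖t b‖ ≤ 1 / 8 * ‖t b‖ :=
      mul_le_mul_of_nonneg_right (by linarith) (norm_nonneg _)
    have h9 : (1 / 4) ^ n * ‖t g‖ ≤ (1 / 2) ^ n * ‖t g‖ :=
      mul_le_mul_of_nonneg_right hp2 (norm_nonneg _)
    have h10 : 0 ≤ (1 / 4) ^ n * ‖t g‖ := by positivity
    have h11 : 0 ≤ (1 / 2) ^ n * ‖t h‖ := by positivity
    nlinarith

/-- By discreteness the bounded sequence of commutators takes finitely many values, so one recurs
infinitely often; the decaying bounds make that value trivial. -/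
theorem exists_iterComm_trivial (ht : ∀ g h, t (g * h) = t g + L g (t h))
    (hfin : ∀ R, {g | ‖t g‖ ≤ R}.Finite) {g h : S}
    (hg : NearOne (L g) (1 / 8)) (hh : NearOne (L h) (1 / 8)) :
    ∃ n, L (iterComm g h (n + 1)) = 1 ∧ t (iterComm g h (n + 1)) = 0 := by
  have hb := iterComm_bound L t ht hg hh
  set K := ‖t h‖ + 4 * ‖t g‖ with hK
  have hK0 : 0 ≤ K := by positivity
  have := (hfin K).to_subtype
  let φ : ℕ → {g | ‖t g‖ ≤ K} := fun n => ⟨iterComm g h (n + 1), (hb (n + 1)).2.trans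
    (mul_le_of_le_one_left hK0 (pow_le_one₀ (by norm_num) (by norm_num)))⟩
  obtain ⟨y, hy⟩ := Finite.exists_infinite_fiber φ
  have hy' : (φ ⁻¹' {y}).Infinite := Set.infinite_coe_iff.1 hy
  have hsmall : ∀ c : ℝ, 0 < c → ∃ n, φ n = y ∧ ((1 : ℝ) / 2) ^ (n + 1) ≤ c := by
    intro c hc
    obtain ⟨N, hN⟩ := exists_pow_lt_of_lt_one hc (by norm_num : (1 / 2 : ℝ) < 1)
    obtain ⟨n, hn, hNn⟩ := hy'.exists_gt N
    exact ⟨n, hn, (pow_le_pow_of_le_one (by norm_num) (by norm_num) (by omega)).trans hN.le⟩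
  have h1 : t y = 0 := by
    rw [← norm_le_zero_iff]
    refine le_of_forall_pos_le_add fun ε hε => ?_
    obtain ⟨n, rfl, hn⟩ := hsmall (ε / (K + 1)) (by positivity)
    have := (hb (n + 1)).2
    change ‖t (iterComm g h (n + 1))‖ ≤ _
    rw [le_div_iff₀ (by positivity)] at hn
    have : (0 : ℝ) ≤ (1 / 2) ^ (n + 1) := by positivity
    linarith
  have h2 : L y = 1 := by
    ext x
    rw [linIsom_one_apply, ← sub_eq_zero, ← norm_le_zero_iff]
    refine le_of_forall_pos_le_add fun ε hε => ?_
    obtain ⟨n, rfl, hn⟩ := hsmall (ε / (‖x‖ + 1)) (by positivity)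
    have h3 := (hb (n + 1)).1 x
    change ‖L (iterComm g h (n + 1)) x - x‖ ≤ _
    rw [le_div_iff₀ (by positivity)] at hn
    have h4 : (0 : ℝ) ≤ (1 / 2) ^ (n + 1) := by positivity
    have h5 : ((1 : ℝ) / 4) ^ (n + 1) / 8 ≤ (1 / 2) ^ (n + 1) := by
      have : ((1 : ℝ) / 4) ^ (n + 1) ≤ (1 / 2) ^ (n + 1) :=
        pow_le_pow_left₀ (by norm_num) (by norm_num) _
      linarith
    have h6 := mul_le_mul_of_nonneg_right h5 (norm_nonneg x)
    linarith
  obtain ⟨n, rfl, -⟩ := hsmall 1 one_pos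
  exact ⟨n, h2, h1⟩

/-- Descends from a trivial iterated commutator: `commute_of_commute_conj` removes one commutator
from the rotations, and `apply_sub_self_eq_zero` one from the translations. -/
theorem commutator_of_nearOne (ht : ∀ g h, t (g * h) = t g + L g (t h))
    (hfin : ∀ R, {g | ‖t g‖ ≤ R}.Finite) {g h : S}
    (hg : NearOne (L g) (1 / 8)) (hh : NearOne (L h) (1 / 8)) :
    L g (t ⁅g, h⁆) = t ⁅g, h⁆ ∧ L ⁅g, h⁆ = 1 := by
  have hb := iterComm_bound L t ht hg hh
  have hdown : ∀ n, (L g (t (iterComm g h (n + 1))) = t (iterComm g h (n + 1)) ∧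
      L (iterComm g h (n + 1)) = 1) → L g (t ⁅g, h⁆) = t ⁅g, h⁆ ∧ L ⁅g, h⁆ = 1 := by
    intro n
    induction n with
    | zero => exact id
    | succ n ih =>
      rintro ⟨h1, h2⟩
      apply ih
      set b := iterComm g h n with hb'
      have hc : iterComm g h (n + 1) = ⁅g, b⁆ := rfl
      have hcc : iterComm g h (n + 1 + 1) = ⁅g, ⁅g, b⁆⁆ := rfl
      rw [hcc] at h1 h2
      rw [hc]
      have h3 : L ⁅g, b⁆ = 1 := by
        rw [map_commutatorElement, commutatorElement_eq_one_iff_commute] at h2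
        rw [map_commutatorElement, commutatorElement_eq_one_iff_commute]
        refine commute_of_commute_conj (c := 1 / 8) (by norm_num) ((hb n).1.mono ?_) ?_
        · have : ((1 : ℝ) / 4) ^ n ≤ 1 := pow_le_one₀ (by norm_num) (by norm_num)
          linarith
        · rw [map_commutatorElement, commutatorElement_def] at h2
          have h4 : Commute (L g) (L b * (L g)⁻¹ * (L b)⁻¹) := by
            have := (Commute.refl (L g)).inv_right.mul_right h2
            rwa [mul_assoc, mul_assoc, inv_mul_cancel_left, ← mul_assoc] at this
          have := h4.inv_right
          convert this using 1
          group
      refine ⟨apply_sub_self_eq_zero ?_, h3⟩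
      have h5 : t ⁅g, ⁅g, b⁆⁆ = L g (t ⁅g, b⁆) - t ⁅g, b⁆ := by
        rw [crossed_commutator L t ht, h2, h3]
        simp only [linIsom_one_apply]
        abel
      rw [← h5]; exact h1
  obtain ⟨n, h1, h2⟩ := exists_iterComm_trivial L t ht hfin hg hh
  exact hdown n ⟨by rw [h2, map_zero], h1⟩

/-- Take `γ n` with translation part near `n • u`. By compactness two linear parts `L (γ j)`, `L (γ
k)` are `ε`-close with `k` far beyond `j`; then `γ k * (γ j)⁻¹` works. -/
theorem exists_nearOne_direction [FiniteDimensional ℝ E]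
    (ht : ∀ g h, t (g * h) = t g + L g (t h))
    (hcob : ∃ R, ∀ x, ∃ g, ‖t g - x‖ ≤ R) (u : E) {ε : ℝ} (hε : 0 < ε) :
    ∃ g, NearOne (L g) ε ∧ ∃ s : ℝ, 1 ≤ s ∧ ‖t g - s • u‖ ≤ ε * s := by
  obtain ⟨R, hR⟩ := hcob
  choose γ hγ using fun n : ℕ => hR ((n : ℝ) • u)
  have : ProperSpace (E →L[ℝ] E) := FiniteDimensional.proper ℝ _
  obtain ⟨M, -, φ, hφ, hM⟩ := tendsto_subseq_of_bounded
    (Metric.isBounded_closedBall (x := (0 : E →L[ℝ] E)) (r := 1))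
    (x := fun n => ((L (γ n)).toContinuousLinearEquiv : E →L[ℝ] E)) (fun n => by
      rw [mem_closedBall_zero_iff]
      exact ContinuousLinearMap.opNorm_le_bound _ zero_le_one fun x => by simp)
  obtain ⟨N, hN⟩ := Metric.cauchySeq_iff'.1 hM.cauchySeq ε hε
  -- Makes `k - j` at least 1 and large enough for `ε * (k - j)` to absorb the error, which is
  -- bounded in terms of `j`.
  obtain ⟨m, hm⟩ := exists_nat_gt ((φ N : ℝ) + 1 + (R + ‖t (γ (φ N))‖ + φ N * ‖u‖) / ε)
  set j := φ N with hj
  set n := max m N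
  set k := φ n with hk
  have hkm : (m : ℝ) ≤ k := by
    exact_mod_cast (le_max_left m N).trans (hφ.id_le n)
  have hR0 : 0 ≤ R := (norm_nonneg _).trans (hγ 0)
  have hdiv : 0 ≤ (R + ‖t (γ j)‖ + j * ‖u‖) / ε := by positivity
  have hn := hN n (le_max_right m N)
  rw [dist_eq_norm] at hn
  have hkj : ∀ x, ‖L (γ k) x - L (γ j) x‖ ≤ ε * ‖x‖ := fun x =>
    (ContinuousLinearMap.le_opNorm _ x).trans (mul_le_mul_of_nonneg_right hn.le (norm_nonneg x))
  refine ⟨γ k * (γ j)⁻¹, fun x => ?_, (k : ℝ) - j, by linarith, ?_⟩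
  · have := hkj ((L (γ j))⁻¹ x)
    rw [← linIsom_mul_apply, ← linIsom_mul_apply, mul_inv_cancel] at this
    simpa using this
  · have h1 : t (γ k) = t (γ k * (γ j)⁻¹) + L (γ k * (γ j)⁻¹) (t (γ j)) := by
      rw [← ht, inv_mul_cancel_right]
    have e : t (γ k * (γ j)⁻¹) - ((k : ℝ) - j) • u =
        (t (γ k) - (k : ℝ) • u) - L (γ k * (γ j)⁻¹) (t (γ j)) + (j : ℝ) • u := by
      rw [h1, sub_smul]; abel
    rw [e]
    have h2 := norm_add_le ((t (γ k) - (k : ℝ) • u) - L (γ k * (γ j)⁻¹) (t (γ j))) ((j : ℝ) • u)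
    have h3 := norm_sub_le (t (γ k) - (k : ℝ) • u) (L (γ k * (γ j)⁻¹) (t (γ j)))
    rw [LinearIsometryEquiv.norm_map] at h3
    rw [norm_smul, Real.norm_natCast] at h2
    have h4 := hγ k
    have h5 : (R + ‖t (γ j)‖ + j * ‖u‖) / ε ≤ (k : ℝ) - j := by linarith
    rw [div_le_iff₀ hε] at h5
    linarith

/-- If `L g` moves `u`, take `h` almost a long translation along `u`. Then `t ⁅g, h⁆` is nearly a
large multiple of `w = L g u - u`, yet it is fixed by `L g` and so orthogonal to `w`. -/
theorem eq_one_of_nearOne [FiniteDimensional ℝ E] (ht : ∀ g h, t (g * h) = t g + L g (t h))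
    (hfin : ∀ R, {g | ‖t g‖ ≤ R}.Finite) (hcob : ∃ R, ∀ x, ∃ g, ‖t g - x‖ ≤ R)
    {g : S} (hg : NearOne (L g) (1 / 8)) : L g = 1 := by
  ext u
  rw [linIsom_one_apply]
  by_contra hu
  set w := L g u - u with hw
  have hpos : 0 < ‖w‖ := norm_pos_iff.2 (sub_ne_zero.2 hu)
  have hD : 0 < 8 * (‖w‖ + 1 + ‖t g‖) := by positivity
  set ε := ‖w‖ / (8 * (‖w‖ + 1 + ‖t g‖)) with hε
  have hε0 : 0 < ε := by positivity
  have hεD : ε * (8 * (‖w‖ + 1 + ‖t g‖)) = ‖w‖ := div_mul_cancel₀ _ hD.ne'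
  have hε8 : ε ≤ 1 / 8 := by
    rw [hε, div_le_iff₀ hD]; linarith [norm_nonneg (t g)]
  obtain ⟨h, hh, s, hs, hb⟩ := exists_nearOne_direction L t ht hcob u hε0
  obtain ⟨h1, h2⟩ := commutator_of_nearOne L t ht hfin hg (hh.mono hε8)
  have hperp : inner ℝ w (t ⁅g, h⁆) = 0 := by
    rw [hw, inner_sub_left]
    conv_lhs => enter [1]; rw [← h1, LinearIsometryEquiv.inner_map_map]
    exact sub_self _
  have e : t ⁅g, h⁆ = s • w + (L g (t h - s • u) - (t h - s • u)) - (L h (t g) - t g) := by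
    rw [crossed_commutator L t ht, h2, hw, linIsom_one_apply, map_sub, map_smul,
      smul_sub]
    abel
  rw [e, inner_sub_right, inner_add_right, real_inner_smul_right,
    real_inner_self_eq_norm_sq] at hperp
  have h3 := (abs_le.1 (abs_real_inner_le_norm w (L g (t h - s • u) - (t h - s • u)))).1
  have h4 := (abs_le.1 (abs_real_inner_le_norm w (L h (t g) - t g))).2
  have h5 := hg (t h - s • u)
  have h6 := hh (t g)
  have h7 := mul_le_mul_of_nonneg_left h5 hpos.le
  have h8 := mul_le_mul_of_nonneg_left h6 hpos.le
  have h9 : s * ‖w‖ ≤ ε * s / 8 + ε * ‖t g‖ := by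
    refine le_of_mul_le_mul_left ?_ hpos
    nlinarith
  have h10 : ε * ‖t g‖ ≤ s * (ε * ‖t g‖) := le_mul_of_one_le_left (by positivity) hs
  have h11 : 0 < s * ε := by positivity
  have h12 : 0 ≤ s * (ε * ‖w‖) := by positivity
  have h13 : 0 ≤ s * (ε * ‖t g‖) := by positivity
  have h14 : s * ‖w‖ = 8 * (s * (ε * ‖w‖)) + 8 * (s * ε) + 8 * (s * (ε * ‖t g‖)) := by
    conv_lhs => rw [← hεD]
    ring
  linarith

/-- The first Bieberbach theorem: the translations in a discrete cocompact group of Euclidean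
isometries span. The isometries are given by linear parts `L` and translation parts `t`. -/
theorem span_translations_eq_top [FiniteDimensional ℝ E]
    (ht : ∀ g h, t (g * h) = t g + L g (t h))
    (hfin : ∀ R, {g | ‖t g‖ ≤ R}.Finite) (hcob : ∃ R, ∀ x, ∃ g, ‖t g - x‖ ≤ R) :
    Submodule.span ℝ {v | ∃ g, L g = 1 ∧ t g = v} = ⊤ := by
  set V := Submodule.span ℝ {v | ∃ g, L g = 1 ∧ t g = v}
  rw [← Submodule.orthogonal_eq_bot_iff, Submodule.eq_bot_iff]
  intro u hu
  by_contra hu0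
  have hpos : 0 < ‖u‖ := norm_pos_iff.2 hu0
  -- The bound `1 / 8` makes `g` a translation; `‖u‖ / 2` keeps `t g` from being orthogonal to `u`.
  obtain ⟨g, hg, s, hs, hb⟩ := exists_nearOne_direction L t ht hcob u
    (ε := min (1 / 8) (‖u‖ / 2)) (by positivity)
  have h1 := eq_one_of_nearOne L t ht hfin hcob (hg.mono (min_le_left _ _))
  have h2 : inner ℝ u (t g) = 0 :=
    Submodule.inner_left_of_mem_orthogonal 
      (Submodule.subset_span (show t g ∈ {v | ∃ g, L g = 1 ∧ t g = v} from ⟨g, h1, rfl⟩)) hu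
  have h3 := (abs_le.1 (abs_real_inner_le_norm u (t g - s • u))).1
  rw [inner_sub_right, h2, real_inner_smul_right, real_inner_self_eq_norm_sq] at h3
  have h4 : ‖t g - s • u‖ ≤ ‖u‖ / 2 * s :=
    hb.trans (mul_le_mul_of_nonneg_right (min_le_right _ _) (by linarith))
  have h5 := mul_le_mul_of_nonneg_left h4 hpos.le
  have h6 : 0 < s * ‖u‖ ^ 2 := by positivity
  nlinarith

end Bieberbach

/-! ### Lifting a lattice of translations to commuting group elements. -/

section Lattice

open scoped commutatorElement

/-- By pigeonhole two powers of `b` conjugate `a` to the same element, so their quotient commutes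
with `a`. -/
theorem exists_pow_commute {S : Type*} [Group S] {N : Set S} (hN : N.Finite) (a b : S)
    (h : ∀ n : ℕ, ⁅b ^ n, a⁆ ∈ N) : ∃ p : ℕ, 0 < p ∧ Commute (b ^ p) a := by
  obtain ⟨m, n, hmn, he⟩ := hN.exists_lt_map_eq_of_forall_mem h
  refine ⟨n - m, Nat.sub_pos_of_lt hmn, ?_⟩
  rw [← commutatorElement_eq_one_iff_commute]
  rw [commutatorElement_def, commutatorElement_def, mul_left_inj] at he
  have hn : b ^ n = b ^ m * b ^ (n - m) := by rw [← pow_add, Nat.add_sub_cancel' hmn.le]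
  rw [hn, ← mul_right_inj (b ^ m)⁻¹, ← mul_left_inj (b ^ m)] at he
  rw [commutatorElement_def, mul_inv_eq_one]
  calc _ = (b ^ m)⁻¹ * (b ^ m * b ^ (n - m) * a * (b ^ m * b ^ (n - m))⁻¹) * b ^ m := by group
    _ = (b ^ m)⁻¹ * (b ^ m * a * (b ^ m)⁻¹) * b ^ m := he.symm
    _ = a := by group

theorem commute_zpowersHom {k : ℕ} {S : Type*} [Group S] (h : Fin k → S)
    (hcomm : Pairwise fun i j => Commute (h i) (h j)) :
    Pairwise fun i j => ∀ x y, Commute (zpowersHom S (h i) x) (zpowersHom S (h j) y) :=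
  fun i j hij x y => by simpa [zpowersHom_apply] using ((hcomm hij).zpow_zpow _ _)

/-- The homomorphism from `ℤᵏ` sending the standard basis to a family of commuting elements. -/
noncomputable def zpowCoprod {k : ℕ} {S : Type*} [Group S] (h : Fin k → S)
    (hcomm : Pairwise fun i j => Commute (h i) (h j)) : Multiplicative (Fin k → ℤ) →* S :=
  (MonoidHom.noncommPiCoprod (fun i => zpowersHom S (h i)) (commute_zpowersHom h hcomm)).comp
    (MulEquiv.piMultiplicative fun _ : Fin k => ℤ).toMonoidHom

theorem map_zpowCoprod {k : ℕ} {S M : Type*} [Group S] [CommGroup M] (h : Fin k → S)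
    (hcomm : Pairwise fun i j => Commute (h i) (h j)) (T : S →* M) (z : Fin k → ℤ) :
    T (zpowCoprod h hcomm (Multiplicative.ofAdd z)) = ∏ i, T (h i) ^ z i := by
  simp only [zpowCoprod, MonoidHom.comp_apply, MonoidHom.noncommPiCoprod_apply]
  rw [Finset.map_noncommProd, Finset.noncommProd_eq_prod]
  refine Finset.prod_congr rfl fun i _ => ?_
  rw [zpowersHom_apply, map_zpow]
  rfl

variable {k : ℕ} {S : Type*} [Group S]
  (L : S →* (EuclideanSpace ℝ (Fin k) ≃ₗᵢ[ℝ] EuclideanSpace ℝ (Fin k)))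
  (t : S → EuclideanSpace ℝ (Fin k))

/-- The translation part, as a homomorphism on the group of translations. -/
noncomputable def translationHom (ht : ∀ g h, t (g * h) = t g + L g (t h)) :
    L.ker →* Multiplicative (EuclideanSpace ℝ (Fin k)) :=
  MonoidHom.mk' (fun g => Multiplicative.ofAdd (t g)) fun g h => by
    rw [Subgroup.coe_mul, ht, (MonoidHom.mem_ker.1 g.2)]
    rfl

/-- A discrete cocompact group of isometries of Euclidean `k`-space contains a free abelian
group of rank `k` acting as a lattice of translations. The group need not act faithfully. -/
theorem exists_translation_lattice (ht : ∀ g h, t (g * h) = t g + L g (t h))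
    (hfin : ∀ R, {g | ‖t g‖ ≤ R}.Finite) (hcob : ∃ R, ∀ x, ∃ g, ‖t g - x‖ ≤ R) :
    ∃ (φ : Multiplicative (Fin k → ℤ) →* S)
      (w : Module.Basis (Fin k) ℝ (EuclideanSpace ℝ (Fin k))),
      ∀ z : Fin k → ℤ, L (φ (Multiplicative.ofAdd z)) = 1 ∧
        t (φ (Multiplicative.ofAdd z)) = ∑ i, (z i : ℝ) • w i := by
  have hspan := span_translations_eq_top L t ht hfin hcob
  let b₀ := Module.Basis.ofSpan hspan.ge
  have hb₀ : ∀ i, b₀ i ∈ {v | ∃ g, L g = 1 ∧ t g = v} := fun i =>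
    Module.Basis.ofSpan_subset hspan.ge (Set.mem_range_self i)
  have : Fintype ((linearIndepOn_empty ℝ id).extend
      (Set.empty_subset {v | ∃ g, L g = 1 ∧ t g = v})) := FiniteDimensional.fintypeBasisIndex b₀
  let e := Fintype.equivFinOfCardEq
    ((Module.finrank_eq_card_basis b₀).symm.trans (finrank_euclideanSpace_fin (𝕜 := ℝ) (n := k)))
  let b := b₀.reindex e
  have hb : ∀ i, ∃ g : L.ker, t g = b i := fun i => by
    obtain ⟨g, hg, h⟩ := hb₀ (e.symm i)
    exact ⟨⟨g, hg⟩, by rw [h]; exact (b₀.reindex_apply e i).symm⟩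
  choose g hg using hb
  set T := translationHom L t ht with hT
  have hker : {x : L.ker | T x = 1}.Finite := by
    refine ((hfin 0).preimage Subtype.val_injective.injOn).subset fun x hx => ?_
    have : t x = 0 := hx
    simp [this]
  -- Translations commute, so commutators of lifts lie in the finite kernel of `T`.
  have hpow : ∀ i j, ∃ p : ℕ, 0 < p ∧ Commute (g j ^ p) (g i) := fun i j =>
    exists_pow_commute hker (g i) (g j) fun n => by
      change T _ = 1
      rw [map_commutatorElement, commutatorElement_eq_one_iff_commute]
      exact Commute.all _ _
  choose p hp0 hp using hpow
  set M := ∏ i, ∏ j, p i j with hM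
  have hM0 : 0 < M := Finset.prod_pos fun i _ => Finset.prod_pos fun j _ => hp0 i j
  have hcomm : ∀ i j, Commute (g j ^ M) (g i) := fun i j => by
    obtain ⟨c, hc⟩ : p i j ∣ M := (Finset.dvd_prod_of_mem (p i) (Finset.mem_univ j)).trans
      (Finset.dvd_prod_of_mem (fun i => ∏ j, p i j) (Finset.mem_univ i))
    rw [hc, pow_mul]
    exact (hp i j).pow_left c
  let φ := zpowCoprod (fun i => g i ^ M) fun i j _ => (hcomm j i).pow_right M
  refine ⟨L.ker.subtype.comp φ, b.isUnitSMul (w := fun _ => (M : ℝ))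
    fun _ => (Nat.cast_ne_zero.2 hM0.ne').isUnit, fun z =>
      ⟨MonoidHom.mem_ker.1 (φ (Multiplicative.ofAdd z)).2, ?_⟩⟩
  have h1 := map_zpowCoprod (fun i => g i ^ M) (fun i j _ => (hcomm j i).pow_right M) T z
  have h2 := congrArg Multiplicative.toAdd h1
  rw [toAdd_prod] at h2
  refine h2.trans (Finset.sum_congr rfl fun i _ => ?_)
  rw [Module.Basis.isUnitSMul_apply, map_pow, toAdd_zpow, toAdd_pow, ← hg i,
    Nat.cast_smul_eq_nsmul, Int.cast_smul_eq_zsmul]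
  rfl

end Lattice

/-! ### The quotient torus. -/

section Torus

variable {X : Type*} [MetricSpace X] {k : ℕ}

theorem unitAddCircle_coe_eq_iff (x y : ℝ) :
    (x : UnitAddCircle) = y ↔ ∃ n : ℤ, x = y + n := by
  rw [QuotientAddGroup.eq, AddSubgroup.mem_zmultiples_iff]
  constructor
  · rintro ⟨n, hn⟩
    exact ⟨-n, by simp at hn; push_cast; linarith⟩
  · rintro ⟨n, hn⟩
    exact ⟨-n, by simp; linarith⟩

/-- Coordinates in `w`, reduced modulo 1, give an open quotient map `q` whose fibres are the
`A`-orbits. -/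
theorem nonempty_flatQuotient_homeomorph_torus {A : Type*} [Group A] [MulAction A X] {F : Set X}
    {f : EuclideanSpace ℝ (Fin k) → X} (hf : Isometry f) (hF : Set.range f = F)
    (w : Module.Basis (Fin k) ℝ (EuclideanSpace ℝ (Fin k)))
    (h₁ : ∀ a : A, ∃ z : Fin k → ℤ, ∀ x, a • f x = f (x + ∑ i, (z i : ℝ) • w i))
    (h₂ : ∀ z : Fin k → ℤ, ∃ a : A, ∀ x, a • f x = f (x + ∑ i, (z i : ℝ) • w i)) :
    Nonempty (FlatQuotient A F ≃ₜ UnitAddTorus (Fin k)) := by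
  subst hF
  let e := hf.isometryEquivOnRange.toHomeomorph
  let q : Set.range f → UnitAddTorus (Fin k) :=
    Pi.map (fun _ (x : ℝ) => (x : UnitAddCircle)) ∘ w.equivFunL ∘ e.symm
  have hq : IsOpenQuotientMap q :=
    (IsOpenQuotientMap.piMap fun _ => QuotientAddGroup.isOpenQuotientMap_mk).comp
      (w.equivFunL.toHomeomorph.isOpenQuotientMap.comp e.symm.isOpenQuotientMap)
  have hqf : ∀ x i, q (e x) i = (w.repr x i : UnitAddCircle) := fun x i => by
    simp [q]
  have hker : (MulAction.orbitRel A X).comap (Subtype.val : Set.range f → X) = Setoid.ker q := by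
    ext a b
    obtain ⟨x, rfl⟩ := e.surjective a
    obtain ⟨y, rfl⟩ := e.surjective b
    rw [Setoid.comap_rel, MulAction.orbitRel_apply, Setoid.ker_def]
    have hz : ∀ z : Fin k → ℤ, x = y + ∑ i, (z i : ℝ) • w i ↔
        ∀ i, w.repr x i = w.repr y i + z i := fun z => by
      rw [← w.repr.injective.eq_iff, Finsupp.ext_iff]
      refine forall_congr' fun i => ?_
      rw [map_add, Finsupp.add_apply, Module.Basis.repr_sum_self w (fun i => (z i : ℝ))]
    have hq' : q (e x) = q (e y) ↔ ∃ z : Fin k → ℤ, x = y + ∑ i, (z i : ℝ) • w i := by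
      simp_rw [hz, funext_iff, hqf, unitAddCircle_coe_eq_iff]
      exact Classical.skolem
    rw [hq']
    change f x ∈ MulAction.orbit A (f y) ↔ _
    constructor
    · rintro ⟨a, ha⟩
      obtain ⟨z, hz⟩ := h₁ a
      exact ⟨z, hf.injective (ha.symm.trans (hz y))⟩
    · rintro ⟨z, hz⟩
      obtain ⟨a, ha⟩ := h₂ z
      exact ⟨a, (ha y).trans (by rw [hz])⟩
  unfold FlatQuotient
  rw [hker]
  exact ⟨Topology.IsQuotientMap.homeomorph (f := ⟨q, hq.continuous⟩) hq.isQuotientMap⟩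

end Torus

/-! ### Properness of `X`, local finiteness, and the stabilizer of a flat. -/

section Geometry

open scoped Pointwise Topology

variable {G X : Type*} [Group G] [MetricSpace X] [MulAction G X]

theorem IsGeometricAction.weaklyLocallyCompactSpace (hG : IsGeometricAction G X) :
    WeaklyLocallyCompactSpace X := by
  have := hG.isometric
  have := hG.properlyDiscontinuous
  obtain ⟨K, hK, hcov⟩ := hG.cocompact
  refine ⟨fun x => ?_⟩
  have hcomp : ∀ g : G, IsCompact ((g • ·) '' K) := fun g =>
    hK.image (isometry_smul X g).continuous
  set T := {g : G | ((g • ·) '' K ∩ {x}).Nonempty} with hT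
  have hTfin : T.Finite := finite_disjoint_inter_image hK isCompact_singleton
  refine ⟨⋃ g ∈ T, (g • ·) '' K, hTfin.isCompact_biUnion fun g _ => hcomp g, ?_⟩
  by_contra hnot
  have hex : ∀ n : ℕ, ∃ y, dist y x < 1 / (n + 1) ∧ y ∉ ⋃ g ∈ T, (g • ·) '' K := by
    intro n
    by_contra! h
    exact hnot (Filter.mem_of_superset (Metric.ball_mem_nhds x Nat.one_div_pos_of_nat)
      fun y hy => h y hy)
  choose y hy hyT using hex
  have hlim : Filter.Tendsto y Filter.atTop (𝓝 x) :=
    tendsto_iff_dist_tendsto_zero.2 (squeeze_zero (fun _ => dist_nonneg) (fun n => (hy n).le)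
      tendsto_one_div_add_atTop_nhds_zero_nat)
  choose g k hk hg using fun n => hcov (y n)
  -- The sequence with its limit is compact, so finitely many translates of `K` cover it; one of
  -- them contains infinitely many `y n`, hence also `x`.
  have hfin := finite_disjoint_inter_image (Γ := G) hK hlim.isCompact_insert_range
  have hmem : ∀ n, g n ∈ {γ : G | ((γ • ·) '' K ∩ insert x (Set.range y)).Nonempty} := fun n =>
    ⟨y n, ⟨k n, hk n, hg n⟩, Set.mem_insert_of_mem _ (Set.mem_range_self n)⟩
  have := hfin.to_subtype
  obtain ⟨⟨γ, _⟩, hγ⟩ := Finite.exists_infinite_fiber (fun n => (⟨g n, hmem n⟩ : {γ : G | _}))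
  have hγ' := Set.infinite_coe_iff.1 hγ
  have hfreq : ∃ᶠ n in Filter.atTop, y n ∈ (γ • ·) '' K := by
    refine (Nat.frequently_atTop_iff_infinite.2 hγ').mono fun n hn => ?_
    have : g n = γ := congrArg Subtype.val hn
    exact ⟨k n, hk n, by rw [← this]; exact hg n⟩
  have hx : x ∈ (γ • ·) '' K := (hcomp γ).isClosed.mem_of_frequently_of_tendsto hfreq hlim
  obtain ⟨n, hn⟩ := hfreq.exists
  exact hyT n (Set.mem_biUnion (show γ ∈ T from ⟨x, hx, rfl⟩) hn)

theorem IsGeometricAction.exists_isCompact_closedBall (hG : IsGeometricAction G X) :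
    ∃ ε > 0, ∀ x : X, IsCompact (Metric.closedBall x ε) := by
  have := hG.isometric
  have := hG.weaklyLocallyCompactSpace
  obtain ⟨K, hK, hcov⟩ := hG.cocompact
  obtain ⟨K', hK', hKK'⟩ := exists_compact_superset hK
  obtain ⟨δ, hδ, hsub⟩ := hK.exists_cthickening_subset_open isOpen_interior hKK'
  refine ⟨δ, hδ, fun x => ?_⟩
  obtain ⟨g, y, hy, rfl⟩ := hcov x
  rw [← Metric.smul_closedBall]
  refine IsCompact.smul g (hK'.of_isClosed_subset Metric.isClosed_closedBall ?_)
  exact (Metric.closedBall_subset_cthickening hy δ).trans (hsub.trans interior_subset)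

/-- Balls of one fixed radius `ε` are compact; larger ones are reached in steps of `ε / 2` along
geodesics. -/
theorem IsGeometricAction.properSpace (hX : IsCAT0 X) (hG : IsGeometricAction G X) :
    ProperSpace X := by
  obtain ⟨ε, hε, hball⟩ := hG.exists_isCompact_closedBall
  have key : ∀ (x : X) (n : ℕ), IsCompact (Metric.closedBall x (n * (ε / 2))) := by
    intro x n
    induction n with
    | zero => simp
    | succ n ih =>
      obtain ⟨N, -, hN, hcov⟩ := ih.finite_cover_balls (half_pos hε)
      refine (hN.isCompact_biUnion fun y _ => hball y).of_isClosed_subset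
        Metric.isClosed_closedBall fun z hz => ?_
      rw [Metric.mem_closedBall, dist_comm] at hz
      push_cast at hz
      obtain ⟨γ, h0, h1, h2⟩ := hX.geodesic x z
      set r : ℝ := n * (ε / 2) with hr
      have hr0 : 0 ≤ r := by positivity
      set s := min r (dist x z) with hs
      have hs0 : 0 ≤ s := le_min hr0 dist_nonneg
      have hsI : s ∈ Set.Icc 0 (dist x z) := ⟨hs0, min_le_right _ _⟩
      have hd1 : dist (γ s) x = s := by
        have := h2 s hsI 0 ⟨le_rfl, dist_nonneg⟩
        rwa [h0, sub_zero, abs_of_nonneg hs0] at this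
      have hd2 : dist z (γ s) = dist x z - s := by
        have := h2 (dist x z) ⟨dist_nonneg, le_rfl⟩ s hsI
        rwa [h1, abs_of_nonneg (by linarith [hsI.2])] at this
      have hd3 : dist x z - s ≤ ε / 2 := by
        rcases min_choice r (dist x z) with h | h <;> rw [hs, h] <;> linarith
      obtain ⟨p, hp, hp'⟩ := Set.mem_iUnion₂.1
        (hcov (show γ s ∈ Metric.closedBall x r from by
          rw [Metric.mem_closedBall, hd1]; exact min_le_left _ _))
      refine Set.mem_biUnion hp ?_
      rw [Metric.mem_closedBall]
      have := dist_triangle z (γ s) p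
      have := Metric.mem_ball.1 hp'
      linarith
  refine ⟨fun x r => ?_⟩
  obtain ⟨n, hn⟩ := exists_nat_gt (r / (ε / 2))
  rw [div_lt_iff₀ (half_pos hε)] at hn
  exact (key x n).of_isClosed_subset Metric.isClosed_closedBall
    (Metric.closedBall_subset_closedBall hn.le)

theorem IsFlat.exists_dist_eq {F : Set X} (hF : IsFlat F) {p : X} (hp : p ∈ F) {r : ℝ}
    (hr : 0 ≤ r) : ∃ q ∈ F, dist p q = r := by
  obtain ⟨k, hk, f, hf, rfl⟩ := hF
  obtain ⟨u, rfl⟩ := hp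
  refine ⟨f (u + EuclideanSpace.single (⟨0, by omega⟩ : Fin k) r), ⟨_, rfl⟩, ?_⟩
  rw [hf.dist_eq, dist_self_add_right, PiLp.norm_single, Real.norm_of_nonneg hr]

theorem HasIsolatedFlatsWith.locallyFinite [ProperSpace X] {𝓕 : Set (Set X)}
    (h𝓕 : HasIsolatedFlatsWith X 𝓕) (x : X) (r : ℝ) :
    {F ∈ 𝓕 | (F ∩ Metric.closedBall x r).Nonempty}.Finite := by
  obtain ⟨ψ, hψ⟩ := h𝓕.isolated
  -- Two points of `F₁` at distance `D > ψ 1` cannot both lie in the overlap of the 1-neighborhoods.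
  set D : ℝ := ψ 1 + 1 with hD
  have hD0 : 0 ≤ D := by positivity
  obtain ⟨N, -, hN, hcov⟩ := (isCompact_closedBall x (r + D)).finite_cover_balls
    (half_pos one_pos)
  -- Records which balls of the finite net a flat meets; flats with equal records are within 1 of
  -- each other on the large ball.
  let sig : Set X → Set X := fun F =>
    {y ∈ N | (F ∩ Metric.closedBall x (r + D) ∩ Metric.ball y (1 / 2)).Nonempty}
  refine Set.Finite.of_finite_image (f := sig)
    (hN.finite_subsets.subset (by rintro _ ⟨F, -, rfl⟩; exact fun y hy => hy.1)) ?_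
  rintro F₁ ⟨hF₁, p, hp, hpx⟩ F₂ ⟨hF₂, -⟩ hsig
  by_contra hne
  obtain ⟨q, hq, hpq⟩ := (h𝓕.isFlat F₁ hF₁).exists_dist_eq hp hD0
  rw [Metric.mem_closedBall] at hpx
  have hmem : ∀ z ∈ F₁, dist z x ≤ r + D →
      z ∈ Metric.thickening ((1 : NNReal) : ℝ) F₁ ∩ Metric.thickening ((1 : NNReal) : ℝ) F₂ := by
    intro z hz hzx
    refine ⟨Metric.self_subset_thickening (by simp) _ hz, ?_⟩
    obtain ⟨y, hy, hzy⟩ := Set.mem_iUnion₂.1 (hcov hzx)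
    have hy' : y ∈ sig F₂ := hsig ▸ ⟨hy, z, ⟨hz, hzx⟩, hzy⟩
    obtain ⟨-, z', ⟨hz', -⟩, hz'y⟩ := hy'
    refine Metric.mem_thickening_iff.2 ⟨z', hz', ?_⟩
    have := dist_triangle_right z z' y
    rw [Metric.mem_ball] at hzy hz'y
    rw [NNReal.coe_one]
    linarith
  have h := hψ F₁ hF₁ F₂ hF₂ hne 1 p (hmem p hp (by linarith)) q (hmem q hq (by
    have := dist_triangle_left q x p
    linarith))
  linarith

theorem IsGeometricAction.exists_stabilizer_dist_le [ProperSpace X]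
    (hG : IsGeometricAction G X) {𝓕 : Set (Set X)}
    (h𝓕 : HasIsolatedFlatsWith X 𝓕) {F : Set X} (hF : F ∈ 𝓕) (p : X) :
    ∃ R, ∀ x ∈ F, ∃ g ∈ MulAction.stabilizer G F, dist (g • p) x ≤ R := by
  have := hG.isometric
  obtain ⟨K, hK, hcov⟩ := hG.cocompact
  have hinv : ∀ g : G, g • F ∈ 𝓕 := fun g => h𝓕.equivariant (IsometryEquiv.constSMul g) F hF
  set D := {F' | (∃ g : G, g⁻¹ • F = F') ∧ (F' ∩ K).Nonempty} with hD
  obtain ⟨r, hr⟩ := hK.isBounded.subset_closedBall p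
  have hDfin : D.Finite := (h𝓕.locallyFinite p r).subset (by
    rintro _ ⟨⟨g, rfl⟩, h⟩
    exact ⟨hinv _, h.mono (Set.inter_subset_inter_right _ hr)⟩)
  -- One representative for each of the finitely many translates meeting `K`; correcting `g` by it
  -- gives an element of the stabilizer at bounded cost.
  choose! c hc using fun F' (h : F' ∈ D) => h.1
  have hbdd : Bornology.IsBounded (⋃ F' ∈ D, c F' • K) :=
    (Bornology.isBounded_biUnion hDfin).2 fun F' _ => (hK.smul (c F')).isBounded
  obtain ⟨R, hR⟩ := hbdd.subset_closedBall p
  refine ⟨R, fun x hx => ?_⟩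
  obtain ⟨g, y, hy, rfl⟩ := hcov x
  have hmem : g⁻¹ • F ∈ D := ⟨⟨g, rfl⟩, y, Set.mem_inv_smul_set_iff.2 hx, hy⟩
  set γ := c (g⁻¹ • F) with hγ
  have hγF : γ⁻¹ • F = g⁻¹ • F := hc _ hmem
  refine ⟨g * γ⁻¹, ?_, ?_⟩
  · rw [MulAction.mem_stabilizer_iff, mul_smul, hγF, smul_inv_smul]
  · have h1 : γ • y ∈ Metric.closedBall p R :=
      hR (Set.mem_biUnion hmem (Set.smul_mem_smul_set hy))
    have h2 : g • y = (g * γ⁻¹) • γ • y := by rw [mul_smul, inv_smul_smul]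
    rw [h2, dist_smul, dist_comm]
    exact h1

variable {k : ℕ}

/-- The change of parametrization is a surjective isometry of Euclidean space, so it is affine by
Mazur–Ulam. -/
theorem exists_linearIsometryEquiv_of_range_eq {f f' : EuclideanSpace ℝ (Fin k) → X}
    (hf : Isometry f) (hf' : Isometry f') (h : Set.range f' = Set.range f) :
    ∃ (A : EuclideanSpace ℝ (Fin k) ≃ₗᵢ[ℝ] EuclideanSpace ℝ (Fin k))
      (c : EuclideanSpace ℝ (Fin k)), ∀ x, f' x = f (A x + c) := by
  choose T hT using fun x => (h ▸ Set.mem_range_self x : f' x ∈ Set.range f)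
  choose T' hT' using fun x => (h ▸ Set.mem_range_self x : f x ∈ Set.range f')
  let e : EuclideanSpace ℝ (Fin k) ≃ᵢ EuclideanSpace ℝ (Fin k) :=
    IsometryEquiv.mk' T T' (fun x => hf.injective (by rw [hT, hT']))
      (Isometry.of_dist_eq fun x y => by rw [← hf.dist_eq, hT, hT, hf'.dist_eq])
  refine ⟨e.toRealAffineIsometryEquiv.linearIsometryEquiv, T 0, fun x => ?_⟩
  rw [← hT]
  congr 1
  have := e.toRealAffineIsometryEquiv.map_vadd 0 x
  change e x = e.toRealAffineIsometryEquiv.linearIsometryEquiv x + e 0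
  simpa using this

theorem exists_crossedHom_of_stabilizer [IsIsometricSMul G X]
    {f : EuclideanSpace ℝ (Fin k) → X} (hf : Isometry f) :
    ∃ (L : MulAction.stabilizer G (Set.range f) →*
        (EuclideanSpace ℝ (Fin k) ≃ₗᵢ[ℝ] EuclideanSpace ℝ (Fin k)))
      (t : MulAction.stabilizer G (Set.range f) → EuclideanSpace ℝ (Fin k)),
      (∀ g h, t (g * h) = t g + L g (t h)) ∧ ∀ g x, g • f x = f (L g x + t g) := by
  choose L t hLt using fun g : MulAction.stabilizer G (Set.range f) =>
    exists_linearIsometryEquiv_of_range_eq (f' := fun x => (g : G) • f x) hf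
      ((isometry_smul X (g : G)).comp hf) (by
        conv_rhs => rw [← MulAction.mem_stabilizer_iff.1 g.2]
        rw [Set.smul_set_range])
  have hmul : ∀ g h x, L (g * h) x + t (g * h) = L g (L h x) + (t g + L g (t h)) := by
    intro g h x
    apply hf.injective
    rw [← hLt, Subgroup.coe_mul, mul_smul, hLt h, hLt g, map_add]
    congr 1
    abel
  have ht : ∀ g h, t (g * h) = t g + L g (t h) := fun g h => by simpa using hmul g h 0
  exact ⟨MonoidHom.mk' L fun g h => LinearIsometryEquiv.ext fun x => by
    simpa [ht] using hmul g h x, t, ht, hLt⟩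

/-- One parametrization suffices, as affine isometries conjugate translations to translations. -/
theorem actsByTranslations_of_isometry {A : Type*} [Group A] [MulAction A X]
    {f : EuclideanSpace ℝ (Fin k) → X} (hf : Isometry f)
    (h : ∀ a : A, ∃ v, ∀ x, a • f x = f (x + v)) : ActsByTranslations A k (Set.range f) := by
  intro f' hf' hrange a
  obtain ⟨B, c, hB⟩ := exists_linearIsometryEquiv_of_range_eq hf hf' hrange
  obtain ⟨v, hv⟩ := h a
  refine ⟨B.symm v, fun x => ?_⟩
  rw [hB, hv, hB, map_add, B.apply_symm_apply]
  congr 1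
  abel

end Geometry

/-! ### Periodicity of the flats. -/

theorem theorem3p6 {G X : Type*} [Group G] [MetricSpace X] [MulAction G X]
    (hX : IsCAT0 X) (hG : IsGeometricAction G X)
    (𝓕 : Set (Set X)) (h𝓕 : HasIsolatedFlatsWith X 𝓕)
    (F : Set X) (hF : F ∈ 𝓕) :
    ∃ k : ℕ, IsPeriodicFlat G k F := by
  have := hG.isometric
  have := hG.properlyDiscontinuous
  have := hG.properSpace hX
  obtain ⟨k, hk, f, hf, rfl⟩ := h𝓕.isFlat F hF
  obtain ⟨L, t, ht, hLt⟩ := exists_crossedHom_of_stabilizer (G := G) hf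
  have h0 : ∀ g, f (t g) = g • f 0 := fun g => by rw [hLt, map_zero, zero_add]
  have hfin : ∀ R, {g | ‖t g‖ ≤ R}.Finite := by
    intro R
    have hK := isCompact_closedBall (f 0) R
    refine ((finite_disjoint_inter_image (Γ := G) hK hK).preimage
      Subtype.val_injective.injOn).subset fun g hg => ?_
    have hd : dist (g • f 0) (f 0) ≤ R := by
      rw [← h0, hf.dist_eq, dist_zero_right]; exact hg
    exact ⟨g • f 0, ⟨f 0, Metric.mem_closedBall_self (dist_nonneg.trans hd), rfl⟩, hd⟩
  have hcob : ∃ R, ∀ x, ∃ g, ‖t g - x‖ ≤ R := by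
    obtain ⟨R, hR⟩ := hG.exists_stabilizer_dist_le h𝓕 hF (f 0)
    refine ⟨R, fun x => ?_⟩
    obtain ⟨g, hg, h⟩ := hR (f x) ⟨x, rfl⟩
    refine ⟨⟨g, hg⟩, ?_⟩
    rw [← dist_eq_norm, ← hf.dist_eq, h0]
    exact h
  obtain ⟨φ, w, hφ⟩ := exists_translation_lattice L t ht hfin hcob
  let Φ := (Subgroup.subtype _).comp φ
  have hact : ∀ (z : Fin k → ℤ) x,
      Φ (Multiplicative.ofAdd z) • f x = f (x + ∑ i, (z i : ℝ) • w i) := fun z x => by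
    rw [← (hφ z).2]
    refine (hLt (φ (Multiplicative.ofAdd z)) x).trans ?_
    rw [(hφ z).1]
    rfl
  -- The image of `f 0` determines `z` through its coordinates in `w`.
  have hinj : Function.Injective Φ := by
    intro z z' h
    have h1 := hf.injective ((hact z.toAdd 0).symm.trans
      ((congrArg (· • f 0) h).trans (hact z'.toAdd 0)))
    rw [zero_add, zero_add] at h1
    refine Multiplicative.toAdd.injective (funext fun i => ?_)
    have h2 := congrArg (fun v => w.repr v i) h1
    simpa only [Module.Basis.repr_sum_self w (fun i => (z.toAdd i : ℝ)),
      Module.Basis.repr_sum_self w (fun i => (z'.toAdd i : ℝ)), Int.cast_inj] using h2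
  have h₁ : ∀ a : Φ.range, ∃ z : Fin k → ℤ, ∀ x,
      a • f x = f (x + ∑ i, (z i : ℝ) • w i) := by
    rintro ⟨_, z, rfl⟩
    exact ⟨z.toAdd, hact z.toAdd⟩
  have h₂ : ∀ z : Fin k → ℤ, ∃ a : Φ.range, ∀ x,
      a • f x = f (x + ∑ i, (z i : ℝ) • w i) :=
    fun z => ⟨⟨_, Multiplicative.ofAdd z, rfl⟩, hact z⟩
  exact ⟨k, ⟨hk, f, hf, rfl⟩, Φ.range, ⟨(MonoidHom.ofInjective hinj).symm⟩,
    actsByTranslations_of_isometry hf fun a => let ⟨_, hz⟩ := h₁ a; ⟨_, hz⟩,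
    nonempty_flatQuotient_homeomorph_torus hf rfl w h₁ h₂⟩
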